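/- Let $\sigma$ be a finite relational vocabulary, let $k\in\mathbb N$ be at least the arity of every relation symbol of $\sigma$, and let $A,B$ be finite $\sigma$-structures. Let $\mathbf S_k(A)$ be the poset of subsets of $A$ of cardinality at most $k$, and $\mathbf M_k(A)$ the set of $k$-element subsets. Below, $\mathcal S$ denotes a family of sets $\mathcal S(C)$ of functions $C\to B$, $C\in\mathbf S_k(A)$, ordered by pointwise inclusion. It is a presheaf if it is closed under restriction, and flasque if, for all $C'\subseteq C$, every $s\in\mathcal S(C')$ is the restriction of some $t\in\mathcal S(C)$. Let $\mathcal I_k=\mathcal I_k^{A,B}$ be the presheaf for which $\mathcal I_k(C)$ is the set of partial isomorphisms from $A$ to $B$ with domain $C$. * $\mathcal S^{\Diamond}$ is the largest flasque presheaf contained in $\mathcal S$. * $\mathcal S^{\#}(C)$ is the set of $s\in\mathcal S(C)$ such that either $|C|=k$, or $|C|<k$ and there are $s_a\in\mathcal S(C\cup\{a\})$, $a\in A$, with $s_a|_C=s$ and such that $a\mapsto s_a(a)$ is a bijection from $A$ to $B$. The counting fixpoint $\mathcal S^{\mathsf c}$ is the value at which the decreasing sequence $\mathcal S^{\Diamond}\supseteq\mathcal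 S^{\Diamond\#\Diamond}\supseteq\cdots\supseteq\mathcal S^{\Diamond(\#\Diamond)^m}\supseteq\cdots$ stabilizes. * For $s\in\mathcal S(C_0)$ with $C_0\in\mathbf M_k(A)$, the $\mathbb Z$-test holds if there are formal $\mathbb Z$-linear combinations $\alpha_C$ of elements of $\mathcal S(C)$, $C\in\mathbf M_k(A)$, with $\alpha_C|_{C\cap C'}=\alpha_{C'}|_{C\cap C'}$ for all $C,C'\in\mathbf M_k(A)$ (restriction being extended linearly) and $\alpha_{C_0}=1\cdot s$. Then $\mathcal S^{\Box}(C)$ is the set of $s\in\mathcal S(C)$ that pass the $\mathbb Z$-test if $C\in\mathbf M_k(A)$, and $\mathcal S^{\Box}(C)=\mathcal S(C)$ otherwise. * $\mathcal S^{\dagger}$ is the family on $\mathbf S_k(B)$ with $\mathcal S^\dagger(D)=\{t\in\mathcal I_k^{B,A}(D)\mid t^{-1}\in\mathcal S(\operatorname{im}t)\}$, and the symmetrized cohomological reduction is $\mathcal S^{\mathsf s}=\mathcal S^{\Box\dagger\Box\dagger}$. Define $A\equiv^{\mathbb Z}B$ (at level $k$) to mean that the fixpoint at which the decreasing sequence $$\mathcal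 I_k^{\mathsf c}\supseteq\mathcal I_k^{\mathsf c\,\mathsf s\,\mathsf c}\supseteq\cdots\supseteq\mathcal I_k^{\mathsf c(\mathsf s\mathsf c)^m}\supseteq\cdots$$ stabilizes is non-empty (at some $C$). Define $A\equiv_{\mathcal C^k}B$ to mean that $A$ and $B$ satisfy the same sentences of $k$-variable first-order logic (with equality) with counting quantifiers $\exists^{\ge m}x$. Then $$A\cong B\;\Longrightarrow\;A\equiv^{\mathbb Z}B\;\Longrightarrow\;A\equiv_{\mathcal C^k}B .$$ -/

import Mathlib

open FirstOrder

namespace PebbleSheaf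

/-! ### Contexts, local sections, presheaves of partial isomorphisms -/

/-- The poset of subsets of `A` of cardinality at most `k`, ordered by inclusion. -/
abbrev Ctx (k : ℕ) (A : Type*) : Type _ := {C : Finset A // C.card ≤ k}

/-- The `k`-element subsets of `A`. -/
abbrev MaxCtx (k : ℕ) (A : Type*) : Type _ := {C : Ctx k A // C.1.card = k}

/-- Functions from the context `C` to `B`. -/
abbrev Sec {k : ℕ} {A : Type*} (C : Ctx k A) (B : Type*) : Type _ := {a // a ∈ C.1} → B

section Basics

variable {k : ℕ} {A B : Type*}

open scoped Classical in
/-- The context `C ∪ {a}`, for `|C| < k`. -/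
noncomputable def Ctx.add (C : Ctx k A) (a : A) (h : C.1.card < k) : Ctx k A :=
  ⟨insert a C.1, (Finset.card_insert_le a C.1).trans h⟩

theorem Ctx.le_add (C : Ctx k A) (a : A) (h : C.1.card < k) : C ≤ C.add a h := by
  classical
  intro x hx
  simp only [Ctx.add, Finset.mem_insert]
  exact Or.inr hx

theorem Ctx.mem_add (C : Ctx k A) (a : A) (h : C.1.card < k) : a ∈ (C.add a h).1 := by
  simp [Ctx.add]

open scoped Classical in
/-- The context `C ∩ D`. -/
noncomputable def Ctx.inter (C D : Ctx k A) : Ctx k A :=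
  ⟨C.1 ∩ D.1, (Finset.card_le_card Finset.inter_subset_left).trans C.2⟩

theorem Ctx.inter_le_left (C D : Ctx k A) : C.inter D ≤ C := by
  classical
  intro x hx
  simp only [Ctx.inter, Finset.mem_inter] at hx
  exact hx.1

theorem Ctx.inter_le_right (C D : Ctx k A) : C.inter D ≤ D := by
  classical
  intro x hx
  simp only [Ctx.inter, Finset.mem_inter] at hx
  exact hx.2

/-- Restriction of `s : C → B` to `C' ⊆ C`. -/
def res {C' C : Ctx k A} (h : C' ≤ C) (s : Sec C B) : Sec C' B := fun x => s ⟨x.1, h x.2⟩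

open scoped Classical in
/-- The image of `s : C → B`, as a context of `B`. -/
noncomputable def im {C : Ctx k A} (s : Sec C B) : Ctx k B :=
  ⟨C.1.attach.image s, Finset.card_image_le.trans (by simpa using C.2)⟩

theorem exists_of_mem_im {C : Ctx k A} (s : Sec C B) (b : {b // b ∈ (im s).1}) :
    ∃ a : {a // a ∈ C.1}, s a = b.1 := by
  classical
  obtain ⟨a, -, h⟩ := Finset.mem_image.mp b.2
  exact ⟨a, h⟩

/-- The inverse `im s → A` of `s : C → B`; it is meant for injective `s`, where the preimage
chosen here is the only one. -/
noncomputable def inv {C : Ctx k A} (s : Sec C B) : Sec (im s) A :=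
  fun b => (exists_of_mem_im s b).choose.1

/-- `s : C → B` is a partial isomorphism from `A` to `B` with domain `C`, i.e. an isomorphism
between the induced substructures on `C` and on its image (the vocabulary being relational). -/
def IsPartialIso (L : Language) [L.Structure A] [L.Structure B] {C : Ctx k A}
    (s : Sec C B) : Prop :=
  Function.Injective s ∧
    ∀ (n : ℕ) (R : L.Relations n) (x : Fin n → {a // a ∈ C.1}),
      Language.Structure.RelMap R (fun i => (x i).1) ↔
        Language.Structure.RelMap R (fun i => s (x i))

end Basics

/-- A family of sets of local sections `S(C) ⊆ (C → B)`, ordered by pointwise inclusion. It need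
not be closed under restriction. -/
abbrev Family (k : ℕ) (A B : Type*) : Type _ := ∀ C : Ctx k A, Set (Sec C B)

section Operations

variable {k : ℕ} {A B : Type*}

/-- Closure under restriction: the family is a presheaf. -/
def IsPresheaf (S : Family k A B) : Prop :=
  ∀ (C' C : Ctx k A) (h : C' ≤ C), ∀ s ∈ S C, res h s ∈ S C'

/-- All the restriction maps `S(C) → S(C')` are surjective. -/
def IsFlasque (S : Family k A B) : Prop :=
  ∀ (C' C : Ctx k A) (h : C' ≤ C), ∀ s ∈ S C', ∃ t ∈ S C, res h t = s

/-- The presheaf of partial isomorphisms from `A` to `B`. -/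
def partialIsos (L : Language) (k : ℕ) (A B : Type*) [L.Structure A] [L.Structure B] :
    Family k A B :=
  fun _ => {s | IsPartialIso L s}

/-- Coflasquification: the largest flasque presheaf contained in `S`, that is, the union of all
flasque presheaves contained in `S`. -/
def coflasque (S : Family k A B) : Family k A B :=
  fun C => {s | ∃ T : Family k A B, T ≤ S ∧ IsPresheaf T ∧ IsFlasque T ∧ s ∈ T C}

/-- The counting (bijection game) test for `s` in `S`; it imposes nothing if `|C| = k`. -/
def CountTest (S : Family k A B) {C : Ctx k A} (s : Sec C B) : Prop :=
  ∀ h : C.1.card < k, ∃ t : ∀ a : A, Sec (C.add a h) B,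
    (∀ a, t a ∈ S (C.add a h) ∧ res (C.le_add a h) (t a) = s) ∧
      Function.Bijective (fun a : A => t a ⟨a, C.mem_add a h⟩)

/-- The counting reduction: keep the sections that pass the counting test. -/
def countRed (S : Family k A B) : Family k A B :=
  fun C => {s | s ∈ S C ∧ CountTest S s}

/-- The limit of the iteration `S ⊇ F S ⊇ F (F S) ⊇ ⋯` of a deflationary operation `F`.
On finite structures it is reached after finitely many steps, see `exists_iterate_eq_limit`. -/
def limit (F : Family k A B → Family k A B) (S : Family k A B) : Family k A B :=
  fun C => {s | ∀ m : ℕ, s ∈ (F^[m] S) C}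

theorem exists_iterate_eq_limit [Finite A] [Finite B] (F : Family k A B → Family k A B)
    (hF : ∀ S, F S ≤ S) (S : Family k A B) :
    ∃ N : ℕ, ∀ m, N ≤ m → F^[m] S = limit F S := by
  have hanti : Antitone (fun m => F^[m] S) := by
    refine antitone_nat_of_succ_le fun m => ?_
    rw [Function.iterate_succ_apply']
    exact hF _
  obtain ⟨N, hN⟩ := WellFoundedGT.monotone_chain_condition
    (α := (Family k A B)ᵒᵈ) ⟨fun m => OrderDual.toDual (F^[m] S), fun _ _ h => hanti h⟩
  have hN' : ∀ m, N ≤ m → F^[N] S = F^[m] S := fun m hm => hN m hm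
  refine ⟨N, fun m hm => ?_⟩
  rw [← hN' m hm]
  funext C
  ext s
  refine ⟨fun hs j => ?_, fun hs => hs N⟩
  rcases le_total N j with h | h
  · rw [← hN' j h]
    exact hs
  · exact hanti h C hs

/-- The counting fixpoint: alternate counting reduction and coflasquification, starting from the
coflasquification of `S`. -/
def countFix (S : Family k A B) : Family k A B :=
  limit (fun T => coflasque (countRed T)) (coflasque S)

/-- The free abelian group on `S(C)`: formal `ℤ`-linear combinations of elements of `S(C)`. -/
noncomputable def freeAb (S : Family k A B) (C : Ctx k A) : Submodule ℤ (Sec C B →₀ ℤ) :=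
  Finsupp.supported ℤ ℤ (S C)

/-- `s ∈ S(C₀)`, `|C₀| = k`, has a `ℤ`-compatible extension in `S`: a family of formal
`ℤ`-linear combinations `α_C` of elements of `S(C)`, for `C` ranging over the `k`-element subsets,
whose members agree on intersections, with `α_{C₀} = 1 · s`. -/
def ZTest (S : Family k A B) (C₀ : MaxCtx k A) (s : Sec C₀.1 B) : Prop :=
  ∃ α : ∀ C : MaxCtx k A, Sec C.1 B →₀ ℤ,
    (∀ C, α C ∈ freeAb S C.1) ∧
    (∀ C C' : MaxCtx k A,
      Finsupp.mapDomain (res (C.1.inter_le_left C'.1)) (α C) =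
        Finsupp.mapDomain (res (C.1.inter_le_right C'.1)) (α C')) ∧
    α C₀ = Finsupp.single s 1

/-- Cohomological reduction: on `k`-element contexts, keep the sections that pass the `ℤ`-test. -/
def cohomRed (S : Family k A B) : Family k A B :=
  fun C => {s | s ∈ S C ∧ ∀ h : C.1.card = k, ZTest S ⟨C, h⟩ s}

/-- `S†(D)`: the partial isomorphisms `t` from `B` to `A` with domain `D` such that
`t⁻¹ ∈ S(im t)`. -/
def dagger (L : Language) [L.Structure A] [L.Structure B] (S : Family k A B) : Family k B A :=
  fun _ => {t | IsPartialIso L t ∧ inv t ∈ S (im t)}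

/-- Symmetrized cohomological reduction: reduce, take inverses, reduce, take inverses. -/
def symCohomRed (L : Language) [L.Structure A] [L.Structure B] (S : Family k A B) :
    Family k A B :=
  dagger L (cohomRed (dagger L (cohomRed S)))

end Operations

/-- The fixpoint of alternating symmetrized cohomological reduction and the counting fixpoint,
starting from the counting fixpoint of the presheaf of partial isomorphisms. -/
def cohomCountFix (L : Language) (k : ℕ) (A B : Type*) [L.Structure A] [L.Structure B] :
    Family k A B :=
  limit (fun T => countFix (symCohomRed L T)) (countFix (partialIsos L k A B))

/-- The cohomologically refined equivalence (at level `k`): the above fixpoint is non-empty. -/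
def EqZ (L : Language) (k : ℕ) (A B : Type*) [L.Structure A] [L.Structure B] : Prop :=
  ∃ C : Ctx k A, (cohomCountFix L k A B C).Nonempty

/-! ### The `k`-variable logic with counting quantifiers -/

/-- Formulas of the `k`-variable logic with counting quantifiers over the relational vocabulary
`L`, with free variables among `V`. The variables are the elements of `Fin k`, and may be reused:
in `exGe m x φ` (there are at least `m` elements `x` with `φ`) the variable `x` may already be
in `V`. -/
inductive CFormula (L : Language) (k : ℕ) : Finset (Fin k) → Type _
  | verum {V : Finset (Fin k)} : CFormula L k V
  | equal {V : Finset (Fin k)} (x y : {i // i ∈ V}) : CFormula L k V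
  | rel {V : Finset (Fin k)} {n : ℕ} (R : L.Relations n) (x : Fin n → {i // i ∈ V}) :
      CFormula L k V
  | neg {V : Finset (Fin k)} (φ : CFormula L k V) : CFormula L k V
  | conj {V : Finset (Fin k)} (φ ψ : CFormula L k V) : CFormula L k V
  | exGe {V : Finset (Fin k)} (m : ℕ) (x : Fin k) (φ : CFormula L k (insert x V)) :
      CFormula L k V

/-- The valuation of `V ∪ {x}` that sends `x` to `a` and agrees with `v` on the other variables. -/
def extendVal {k : ℕ} {A : Type*} {V : Finset (Fin k)} (v : {i // i ∈ V} → A) (x : Fin k) (a : A) :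
    {i // i ∈ insert x V} → A :=
  fun y => if h : y.1 = x then a else v ⟨y.1, Finset.mem_of_mem_insert_of_ne y.2 h⟩

/-- Satisfaction of a formula in `A` under a valuation of its free variables. -/
def CFormula.Realize {L : Language} {k : ℕ} {A : Type*} [L.Structure A] :
    ∀ {V : Finset (Fin k)}, CFormula L k V → ({i // i ∈ V} → A) → Prop
  | _, .verum, _ => True
  | _, .equal x y, v => v x = v y
  | _, .rel R x, v => Language.Structure.RelMap R (fun i => v (x i))
  | _, .neg φ, v => ¬ φ.Realize v
  | _, .conj φ ψ, v => φ.Realize v ∧ ψ.Realize v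
  | _, .exGe m x φ, v => ∃ s : Finset A, s.card = m ∧ ∀ a ∈ s, φ.Realize (extendVal v x a)

/-- Satisfaction of a sentence. -/
def Satisfies {L : Language} {k : ℕ} (A : Type*) [L.Structure A] (φ : CFormula L k ∅) : Prop :=
  φ.Realize (A := A) (fun i : {i : Fin k // i ∈ (∅ : Finset (Fin k))} =>
    absurd i.2 (Finset.notMem_empty i.1))

/-- `A` and `B` satisfy the same sentences of the `k`-variable logic with counting quantifiers. -/
def EqCk (L : Language) (k : ℕ) (A B : Type*) [L.Structure A] [L.Structure B] : Prop :=
  ∀ φ : CFormula L k ∅, Satisfies A φ ↔ Satisfies B φ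

end PebbleSheaf

/-!
For the first implication, let `f : A ≃ B` be an isomorphism. The restrictions of `f` to the
contexts form a flasque presheaf, pass the counting test with `f` itself as the bijection, and pass
the `ℤ`-test with the one-term combinations `α_C = 1 · f|_C`; the inverses of these restrictions are
the restrictions of `f⁻¹`. So a family containing all restrictions of `f` still does after any of
the reductions (`ContainsRes.countFix`, `ContainsRes.symCohomRed`), and the fixpoint is non-empty.

For the second implication, the fixpoint is contained in the term of index `0` of its defining
sequence, which is the counting fixpoint `S` of the partial isomorphisms; so it is enough that `S`
is non-empty. On finite structures `S` is attained by the iteration, hence is a presheaf all of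
whose sections pass the counting test (`countFix_eq`). It is thus a winning strategy for Duplicator
in the bijective `k`-pebble game: by induction on the formula, a section of `S` that matches two
valuations preserves and reflects satisfaction (`realize_iff_of_mem`). For a counting quantifier
on `x`, forgetting the value of `x` leaves at most `k - 1` pebbled elements, and the counting test
gives a bijection `A → B` that carries witnesses to witnesses.
-/

namespace PebbleSheaf

section

variable {k : ℕ} {A B : Type*}

/-! ### The counting fixpoint -/

theorem coflasque_le (S : Family k A B) : coflasque S ≤ S := by
  rintro C s ⟨T, hT, -, -, hs⟩
  exact hT C hs

theorem isPresheaf_coflasque (S : Family k A B) : IsPresheaf (coflasque S) := by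
  rintro C' C h s ⟨T, hT, hP, hF, hs⟩
  exact ⟨T, hT, hP, hF, hP C' C h s hs⟩

theorem countRed_le (S : Family k A B) : countRed S ≤ S := fun _ _ hs => hs.1

theorem limit_le (F : Family k A B → Family k A B) (S : Family k A B) : limit F S ≤ S :=
  fun _ _ hs => hs 0

theorem countFix_le (S : Family k A B) : countFix S ≤ S :=
  (limit_le _ _).trans (coflasque_le S)

/-- On finite structures the counting fixpoint is fixed by the operation that is iterated. -/
theorem countFix_eq [Finite A] [Finite B] (S : Family k A B) :
    coflasque (countRed (countFix S)) = countFix S := by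
  obtain ⟨N, hN⟩ := exists_iterate_eq_limit (fun T : Family k A B => coflasque (countRed T))
    (fun T => (coflasque_le _).trans (countRed_le T)) (coflasque S)
  have h := hN (N + 1) N.le_succ
  rw [Function.iterate_succ_apply', hN N le_rfl] at h
  exact h

theorem isPresheaf_countFix [Finite A] [Finite B] (S : Family k A B) :
    IsPresheaf (countFix S) := by
  rw [← countFix_eq S]
  exact isPresheaf_coflasque _

theorem countTest_of_mem_countFix [Finite A] [Finite B] {S : Family k A B} {C : Ctx k A}
    {s : Sec C B} (hs : s ∈ countFix S C) : CountTest (countFix S) s := by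
  rw [← countFix_eq S] at hs
  exact (coflasque_le _ C hs).2

/-! ### Isomorphic structures -/

/-- The family contains the restriction of the function `f` to every context. -/
def ContainsRes (f : A → B) (S : Family k A B) : Prop :=
  ∀ C : Ctx k A, (fun a => f a.1 : Sec C B) ∈ S C

theorem ContainsRes.coflasque {f : A → B} {S : Family k A B} (h : ContainsRes f S) :
    ContainsRes f (coflasque S) := by
  refine fun C => ⟨fun D => {fun a : {a // a ∈ D.1} => f a.1}, ?_, ?_, ?_, rfl⟩
  · rintro C s rfl
    exact h C
  · rintro C' C hC s rfl
    rfl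
  · rintro C' C hC s rfl
    exact ⟨_, rfl, rfl⟩

theorem ContainsRes.countRed {f : A → B} (hf : Function.Bijective f) {S : Family k A B}
    (h : ContainsRes f S) : ContainsRes f (countRed S) :=
  fun C => ⟨h C, fun _ => ⟨fun _ a => f a.1, fun _ => ⟨h _, rfl⟩, hf⟩⟩

theorem ContainsRes.limit {f : A → B} {F : Family k A B → Family k A B}
    (hF : ∀ S, ContainsRes f S → ContainsRes f (F S)) {S : Family k A B}
    (h : ContainsRes f S) : ContainsRes f (limit F S) := by
  intro C m
  suffices ContainsRes f (F^[m] S) from this C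
  induction m with
  | zero => exact h
  | succ m ih =>
    rw [Function.iterate_succ_apply']
    exact hF _ ih

theorem ContainsRes.countFix {f : A → B} (hf : Function.Bijective f) {S : Family k A B}
    (h : ContainsRes f S) : ContainsRes f (countFix S) :=
  ContainsRes.limit (fun _ hT => (hT.countRed hf).coflasque) h.coflasque

theorem ContainsRes.cohomRed {f : A → B} {S : Family k A B} (h : ContainsRes f S) :
    ContainsRes f (cohomRed S) := by
  refine fun C => ⟨h C, fun _ => ⟨fun D => Finsupp.single (fun a => f a.1) 1, ?_, ?_, rfl⟩⟩
  · exact fun D => Finsupp.single_mem_supported ℤ 1 (h D.1)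
  · intro D D'
    rw [Finsupp.mapDomain_single, Finsupp.mapDomain_single]
    rfl

variable {L : Language} [L.Structure A] [L.Structure B]

theorem isPartialIso_restrict (f : A ≃[L] B) (C : Ctx k A) :
    IsPartialIso L (fun a => f a.1 : Sec C B) :=
  ⟨fun _ _ h => Subtype.ext (f.injective h), fun _ R x => (f.map_rel R fun i => (x i).1).symm⟩

theorem inv_restrict (f : A ≃[L] B) (C : Ctx k A) :
    inv (fun a => f a.1 : Sec C B) = fun b => f.symm b.1 := by
  funext b
  have h := (exists_of_mem_im (fun a => f a.1 : Sec C B) b).choose_spec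
  exact (f.toEquiv.eq_symm_apply).2 h

theorem ContainsRes.dagger {f : A ≃[L] B} {S : Family k A B} (h : ContainsRes f S) :
    ContainsRes f.symm (dagger L S) := by
  refine fun D => ⟨isPartialIso_restrict f.symm D, ?_⟩
  rw [inv_restrict]
  exact h _

theorem ContainsRes.symCohomRed {f : A ≃[L] B} {S : Family k A B} (h : ContainsRes f S) :
    ContainsRes f (symCohomRed L S) :=
  h.cohomRed.dagger.cohomRed.dagger

theorem eqZ_of_equiv (f : A ≃[L] B) : EqZ L k A B := by
  have h : ContainsRes f (cohomCountFix L k A B) :=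
    ContainsRes.limit (fun _ hT => hT.symCohomRed.countFix f.bijective)
      (ContainsRes.countFix f.bijective fun C => isPartialIso_restrict f C)
  exact ⟨⟨∅, by simp⟩, _, h _⟩

/-! ### The bijection game and counting logic -/

/-- A bijection that carries the solutions of `p` to those of `q` preserves the property of having
at least `m` solutions. -/
theorem exists_card_eq_iff_of_bijective {p : A → Prop} {q : B → Prop} {f : A → B}
    (hf : Function.Bijective f) (h : ∀ a, p a ↔ q (f a)) (m : ℕ) :
    (∃ s : Finset A, s.card = m ∧ ∀ a ∈ s, p a) ↔
      ∃ s : Finset B, s.card = m ∧ ∀ b ∈ s, q b := by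
  let e := Equiv.ofBijective f hf
  constructor
  · rintro ⟨s, rfl, hs⟩
    refine ⟨s.map e.toEmbedding, s.card_map _, fun b hb => ?_⟩
    obtain ⟨a, ha, rfl⟩ := Finset.mem_map.1 hb
    exact (h a).1 (hs a ha)
  · rintro ⟨s, rfl, hs⟩
    refine ⟨s.map e.symm.toEmbedding, s.card_map _, fun a ha => ?_⟩
    obtain ⟨b, hb, rfl⟩ := Finset.mem_map.1 ha
    refine (h _).2 ?_
    have : f (e.symm b) = b := e.apply_symm_apply b
    simpa [this] using hs b hb

/-- Let `S` be a presheaf of partial isomorphisms all of whose sections pass the counting test. If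
a section of `S` carries the valuation `v` to `w`, the two valuations satisfy the same formulas. -/
theorem realize_iff_of_mem {S : Family k A B} (hP : IsPresheaf S)
    (hI : S ≤ partialIsos L k A B) (hC : ∀ C, ∀ s ∈ S C, CountTest S s)
    {V : Finset (Fin k)} (φ : CFormula L k V) (v : {i // i ∈ V} → A) (w : {i // i ∈ V} → B)
    {C : Ctx k A} {s : Sec C B} (hs : s ∈ S C) (hv : ∀ i, v i ∈ C.1)
    (hw : ∀ i, s ⟨v i, hv i⟩ = w i) : φ.Realize v ↔ φ.Realize w := by
  classical
  induction φ generalizing C with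
  | verum => exact Iff.rfl
  | equal x y =>
    simp only [CFormula.Realize]
    rw [← hw x, ← hw y, (hI C hs).1.eq_iff, Subtype.mk.injEq]
  | rel R x =>
    simp only [CFormula.Realize]
    simp_rw [← hw]
    exact (hI C hs).2 _ R fun i => ⟨v (x i), hv (x i)⟩
  | neg φ ih => exact not_congr (ih v w hs hv hw)
  | conj φ ψ ih₁ ih₂ => exact and_congr (ih₁ v w hs hv hw) (ih₂ v w hs hv hw)
  | @exGe V m x φ ih =>
    -- The values under `v` of the variables other than `x`; there are fewer than `k` of them.
    let D₀ : Finset A := {i : {i // i ∈ V} | i.1 ≠ x}.toFinset.image v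
    have hD₀ : D₀.card < k := by
      calc D₀.card ≤ ({i : {i // i ∈ V} | i.1 ≠ x}.toFinset).card := Finset.card_image_le
        _ ≤ ((Finset.univ : Finset (Fin k)).erase x).card :=
          Finset.card_le_card_of_injOn (fun i => i.1) (by intro i hi; simpa using hi)
            (fun _ _ _ _ h => Subtype.ext h)
        _ < k := by
          rw [Finset.card_erase_of_mem (Finset.mem_univ x), Finset.card_univ, Fintype.card_fin]
          have := x.pos
          omega
    let D : Ctx k A := ⟨D₀, hD₀.le⟩
    have hmem : ∀ i : {i // i ∈ V}, i.1 ≠ x → v i ∈ D.1 := fun i hi =>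
      Finset.mem_image_of_mem v (by simpa using hi)
    have hDC : D ≤ C := by
      intro a ha
      obtain ⟨i, -, rfl⟩ := Finset.mem_image.1 ha
      exact hv i
    obtain ⟨t, ht, hbij⟩ := hC D _ (hP D C hDC s hs) hD₀
    refine exists_card_eq_iff_of_bijective hbij (fun a => ?_) m
    have hv' : ∀ i, extendVal v x a i ∈ (D.add a hD₀).1 := by
      intro i
      unfold extendVal
      split_ifs with hi
      · exact D.mem_add a hD₀
      · exact D.le_add a hD₀ (hmem _ hi)
    refine ih _ _ (ht a).1 hv' fun i => ?_
    by_cases hi : i.1 = x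
    · simp [extendVal, hi]
    · simp only [extendVal, hi, dite_false]
      rw [← hw]
      exact congrFun (ht a).2 ⟨_, hmem ⟨i.1, Finset.mem_of_mem_insert_of_ne i.2 hi⟩ hi⟩

theorem eqCk_of_countFix_nonempty [Finite A] [Finite B] {C : Ctx k A}
    (h : (countFix (partialIsos L k A B) C).Nonempty) : EqCk L k A B := by
  obtain ⟨s, hs⟩ := h
  intro φ
  exact realize_iff_of_mem (isPresheaf_countFix _) (countFix_le _)
    (fun _ _ => countTest_of_mem_countFix) φ _ _ hs
    (fun i => absurd i.2 (Finset.notMem_empty i.1))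
    (fun i => absurd i.2 (Finset.notMem_empty i.1))

end

end PebbleSheaf

theorem mainTheorem12 (L : FirstOrder.Language) [L.IsRelational] [Finite (Σ n, L.Relations n)]
    (k : ℕ) (hk : ∀ n, Nonempty (L.Relations n) → n ≤ k)
    (A B : Type*) [L.Structure A] [L.Structure B] [Finite A] [Finite B] :
    (Nonempty (A ≃[L] B) → PebbleSheaf.EqZ L k A B) ∧
      (PebbleSheaf.EqZ L k A B → PebbleSheaf.EqCk L k A B) := by
  refine ⟨fun ⟨f⟩ => PebbleSheaf.eqZ_of_equiv f, fun ⟨C, s, hs⟩ => ?_⟩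
  exact PebbleSheaf.eqCk_of_countFix_nonempty ⟨s, PebbleSheaf.limit_le _ _ C hs⟩
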